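/- **Setting.** Let $K$ be a knot, $J_{K,n}(q)\in\mathbb Z[q^{\pm1}]$ ($n\ge 0$) its colored Jones polynomial for the $(n+1)$-dimensional irreducible representation of $\mathfrak{sl}_2$, normalized to be $1$ at the unknot. Operators act on sequences by $(Mf)_n=q^nf_n$, $(Lf)_n=f_{n+1}$, so $LM=qML$. In the localized $q$-Weyl algebra $\mathbb Q(M,q)\langle L\rangle/(Lf(M,q)-f(qM,q)L)$, the operators annihilating $(J_{K,n})_n$ form a principal left ideal. The non-commutative $A$-polynomial $P=A_K(M,L,q)=\sum_i a_i(M,q)L^i$ is the left multiple of the monic generator of this ideal by a nonzero element of $\mathbb Z[M,q]$ for which all $a_i\in\mathbb Z[M,q]$ and the $a_i$ have greatest common divisor $1$ in $\mathbb Z[M,q]$ (it is unique up to sign). Write $P=\sum_{(i,j,k)\in\mathcal A}a_{i,j,k}\,q^kM^jL^i$ with all $a_{i,j,k}\ne0$. * $N_P\subset\mathbb R^3$ is the convex hull of $\mathcal A$; $N_{P,0}\subset\mathbb R^2$ is its image under $(i,j,k)\mapsto(i,j)$; $N_{P,1}\subset\mathbb R^2$ is the Newton polygon of $P(M,L,1)$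 in the $(L,M)$-plane. $P$ is *good* if $N_{P,1}=N_{P,0}$. * The tropical curve $\Gamma_K\subset\mathbb R^2$ is the set of points $(x,y)$ at which $\min_{(i,j,k)\in\mathcal A}(ix+jy-k)$ is attained at least twice. * The Newton subdivision $\mathcal S_P$ is the set of the projections to the $(L,M)$-plane of the lower faces of $N_P$, i.e. of the faces on which some functional $(i,j,k)\mapsto ix+jy-k$ is minimal. * $A_K(M,L)\in\mathbb Z[M,L]$ is the $A$-polynomial of $K$: the primitive polynomial without repeated factors and without factors $M$, $L$ (unique up to sign) whose zero set in $(\mathbb C^*)^2$ is the union of the curves contained in the Zariski closure of the set of pairs of eigenvalues, on a common eigenvector, of a meridian ($M$) and the corresponding longitude ($L$) under representations $\pi_1(S^3\setminus K)\to \mathrm{SL}(2,\mathbb C)$. (Reducible representations are included, so $L-1$ is a factor.) A set $\Gamma\subset\mathbb R^2$ is *dual* to a subdivision $\mathcal S$ of a polygon $N$ if $\Gamma$ is the union of the cells of dimension at most $1$ of a finite decomposition $\mathcal C$ of $\mathbb R^2$ into (possibly unbounded) convex polyhedra, and there is an inclusion-reversing bijection $\varphi:\mathcal C\to\mathcal S$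 such that $\dim C+\dim\varphi(C)=2$, $C\perp\varphi(C)$, $C$ is unbounded if and only if $\varphi(C)\subset\partial N$ (the boundary in $\mathbb R^2$), and $\langle u-v,p-p'\rangle\le 0$ for $u\in C$, $v\in D$, $p\in\varphi(C)$, $p'\in\varphi(D)$. **Proposition 3.1.** Suppose that $P=A_K(M,L,q)$ is good and that the AJ Conjecture holds for $K$, i.e. $P(M,L,1)=B(M)\,A_K(M^{1/2},L)$ with $B\in\mathbb Z[M]$. Let $N$ be the Newton polygon of $A_K(M^{1/2},L)\,B(M)$ in the $(L,M)$-plane. Then 1. $N_{P,0}=N$; 2. the Newton polygon of $B(M)$ is the vertical segment from $(0,\operatorname{ord}B)$ to $(0,\deg B)$ (possibly a point), where $\operatorname{ord}B$ is the lowest exponent of $M$ in $B$, and $N$ is the Minkowski sum of the Newton polygon of $A_K(M^{1/2},L)$ and this segment; 3. $\mathcal S_P$ is a polyhedral subdivision of $N$, and $\Gamma_K$ is dual to it. -/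

import Mathlib

open scoped Pointwise

noncomputable section

namespace TropicalKnot

/-! ### Oriented knot diagrams -/

/-- A signed Gauss diagram of an oriented knot with `n ≥ 1` crossings. Walking once around the knot
one makes `2 n` passages through crossings, numbered cyclically by `Fin (2 * n)`;
`passage p = (k, b)` says that passage `p` is through the crossing `k`, on the upper strand if
`b = true` and on the lower strand if `b = false`. `sign k` is the sign of the crossing `k`. -/
structure GaussDiagram where
  n : ℕ
  n_pos : 0 < n
  passage : Fin (2 * n) ≃ Fin n × Bool
  sign : Fin n → ℤˣ

namespace GaussDiagram

variable (G : GaussDiagram)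

/-- The upper passage through the crossing `k`. -/
def upper (k : Fin G.n) : Fin (2 * G.n) := G.passage.symm (k, true)

/-- The lower passage through the crossing `k`. -/
def lower (k : Fin G.n) : Fin (2 * G.n) := G.passage.symm (k, false)

/-- The passage that follows passage `p` (cyclically). -/
def next (p : Fin (2 * G.n)) : Fin (2 * G.n) := finRotate (2 * G.n) p

/-- The passage that precedes passage `p` (cyclically). -/
def prev (p : Fin (2 * G.n)) : Fin (2 * G.n) := (finRotate (2 * G.n)).symm p

/-- The four half-edges at the crossing `k` in counterclockwise order, starting with the incoming
lower one. A half-edge is a pair `(p, b)`: the one that enters (`b = false`) or leaves (`b = true`)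
passage `p`. So slots `0, 2` belong to the lower strand, slots `1, 3` to the upper strand. -/
def slot (k : Fin G.n) : Fin 4 → Fin (2 * G.n) × Bool :=
  if G.sign k = 1 then
    ![(G.lower k, false), (G.upper k, true), (G.lower k, true), (G.upper k, false)]
  else
    ![(G.lower k, false), (G.upper k, false), (G.lower k, true), (G.upper k, true)]

/-- The other half of the edge that contains a given half-edge. -/
def otherHalf : Fin (2 * G.n) × Bool → Fin (2 * G.n) × Bool
  | (p, true) => (G.next p, false)
  | (p, false) => (G.prev p, true)

/-- Two slots are joined by an edge of the diagram. -/
def Joined (d e : Fin G.n × Fin 4) : Prop :=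
  G.slot e.1 e.2 = G.otherHalf (G.slot d.1 d.2)

/-- The faces of the diagram on the surface that it determines: walk along an edge, then turn to
the next slot in counterclockwise order, and repeat. -/
def Face : Type :=
  Quot fun d d' : Fin G.n × Fin 4 => ∃ e, G.Joined d e ∧ d' = (e.1, e.2 + 1)

/-- The writhe. -/
def writhe : ℤ := ∑ k, (G.sign k : ℤ)

end GaussDiagram

/-- A diagram of an oriented knot in 3-space: a Gauss diagram that is drawn on the sphere, that is,
whose Euler characteristic `n - 2 n + (number of faces)` is `2`. -/
structure KnotDiagram extends GaussDiagram where
  planar : Nat.card toGaussDiagram.Face = n + 2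

/-! ### The colored Jones polynomial, through the Kauffman bracket of parallels -/

/-- The field `ℚ(A)`, where `A` is the variable of the Kauffman bracket and `q = A ^ 4`. -/
abbrev KauffmanField : Type := RatFunc ℚ

/-- The variable of the Kauffman bracket. -/
def kauffmanA : KauffmanField := RatFunc.X

/-- The variable `q = A ^ 4`. -/
def qVar : KauffmanField := kauffmanA ^ 4

/-- The value `-A² - A⁻²` of a circle. -/
def circleValue : KauffmanField := -kauffmanA ^ (2 : ℤ) - kauffmanA ^ (-2 : ℤ)

/-- Draw a crossing with slots `0, 1, 2, 3` at its south, east, north and west side, and replace it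
by the `r × r` grid of crossings in which the `i`-th lower strand from the west meets the `j`-th
upper strand from the south. `OnSide r i j s a` says that the crossing `(i, j)` of the grid lies on
the side `s` and is the `a`-th one there in counterclockwise order. -/
def OnSide (r : ℕ) (i j : Fin r) (s : Fin 4) (a : ℕ) : Prop :=
  match s with
  | 0 => j.val = 0 ∧ a = i.val
  | 1 => i.val + 1 = r ∧ a = j.val
  | 2 => j.val + 1 = r ∧ a + i.val + 1 = r
  | 3 => i.val = 0 ∧ a + j.val + 1 = r

namespace GaussDiagram

variable (G : GaussDiagram)

/-- The crossings of the `r`-fold (blackboard) parallel of a diagram. -/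
abbrev CableCrossing (r : ℕ) : Type := Fin G.n × Fin r × Fin r

/-- The edges of the `r`-fold parallel of a diagram: those inside the grids, and the `r` parallel
copies of each edge of the diagram. -/
inductive CableJoined (r : ℕ) : G.CableCrossing r × Fin 4 → G.CableCrossing r × Fin 4 → Prop
  | east (k : Fin G.n) (i i' j : Fin r) (h : i.val + 1 = i'.val) :
      CableJoined r ((k, i, j), 1) ((k, i', j), 3)
  | north (k : Fin G.n) (i j j' : Fin r) (h : j.val + 1 = j'.val) :
      CableJoined r ((k, i, j), 2) ((k, i, j'), 0)
  | outer (k k' : Fin G.n) (s s' : Fin 4) (i j i' j' : Fin r) (a a' : ℕ)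
      (h : G.Joined (k, s) (k', s')) (hs : OnSide r i j s a) (hs' : OnSide r i' j' s' a')
      (ha : a + a' + 1 = r) : CableJoined r ((k, i, j), s) ((k', i', j'), s')

/-- The two smoothings of a crossing. The `A`-smoothing (`true`) joins the two regions that the
upper strand sweeps out when it is turned counterclockwise, so it pairs the slots
`0, 1` and `2, 3`; the other one pairs `0, 3` and `1, 2`. -/
def smoothing : Bool → Fin 4 → Fin 4
  | true => ![1, 0, 3, 2]
  | false => ![3, 2, 1, 0]

/-- The number of circles in a state of the `r`-fold parallel. -/
def circles (r : ℕ) (s : G.CableCrossing r → Bool) : ℕ :=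
  Nat.card (Quot fun d d' : G.CableCrossing r × Fin 4 =>
    G.CableJoined r d d' ∨ (d'.1 = d.1 ∧ d'.2 = smoothing (s d.1) d.2))

/-- The Kauffman bracket of the `r`-fold parallel (the empty link has bracket `1`). -/
def cableBracket (r : ℕ) : KauffmanField :=
  ∑ s : G.CableCrossing r → Bool,
    kauffmanA ^ (∑ c, if s c then (1 : ℤ) else -1) * circleValue ^ G.circles r s

/-- The colored Jones polynomial `J_N(q)`, `q = A ^ 4`, for the irreducible representation of
dimension `N + 1`, of framing zero and equal to `1` for the unknot: the bracket of the diagram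
decorated by the Chebyshev polynomial `S_N` (`S_0 = 1`, `S_1 = z`,
`S_{N+2} = z S_{N+1} - S_N`, with `z ^ r` read as the `r`-fold parallel), corrected by the framing
and divided by its value for the unknot. -/
def coloredJones (N : ℕ) : KauffmanField :=
  ((-1) ^ N * kauffmanA ^ (N ^ 2 + 2 * N)) ^ (-G.writhe) *
    (∑ r ∈ Finset.range (N + 1),
      (((Polynomial.Chebyshev.S ℤ N).coeff r : ℤ) : KauffmanField) * G.cableBracket r) /
    (Polynomial.Chebyshev.S KauffmanField N).eval circleValue

end GaussDiagram

/-! ### The localized `q`-Weyl algebra and the non-commutative `A`-polynomial -/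

/-- `ℤ[M, q]`, as `ℤ[q][M]`: the inner variable is `q`, the outer one is `M`. -/
abbrev ZMq : Type := Polynomial (Polynomial ℤ)

/-- Operators `∑ i, a_i(M, q) L ^ i` with `a_i(M, q) ∈ ℤ[M, q]`, sorted with the powers of `L` to
the right: `P.coeff i = a_i`, and `((P.coeff i).coeff j).coeff k` is the coefficient of
`q ^ k M ^ j L ^ i`. (Only the additive structure of this type is that of operators; they are
multiplied in `WeylLoc`.) -/
abbrev SortedOperator : Type := Polynomial ZMq

/-- The ring homomorphism `f(M, q) ↦ f(q M, q)` of `ℤ[M, q]`. -/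
def shiftPoly : ZMq →+* ZMq :=
  Polynomial.compRingHom (Polynomial.C Polynomial.X * Polynomial.X)

theorem shiftPoly_injective : Function.Injective shiftPoly := by
  rw [injective_iff_map_eq_zero]
  intro f hf
  refine (Polynomial.comp_C_mul_X_eq_zero_iff (r := (Polynomial.X : Polynomial ℤ)) ?_).mp hf
  exact mem_nonZeroDivisors_of_ne_zero Polynomial.X_ne_zero

/-- The field `ℚ(M, q)`. -/
def QMq : Type := FractionRing ZMq

instance : Field QMq := inferInstanceAs (Field (FractionRing ZMq))

instance : Algebra ZMq QMq := inferInstanceAs (Algebra ZMq (FractionRing ZMq))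

instance : IsFractionRing ZMq QMq := inferInstanceAs (IsFractionRing ZMq (FractionRing ZMq))

/-- The endomorphism `f(M, q) ↦ f(q M, q)` of `ℚ(M, q)`. -/
def shift : QMq →+* QMq :=
  IsFractionRing.lift (A := ZMq) (K := QMq) (g := (algebraMap ZMq QMq).comp shiftPoly)
    ((IsFractionRing.injective ZMq QMq).comp shiftPoly_injective)

/-- `L` acts on `ℚ(M, q)` by `shift`, so that `L f(M, q) = f(q M, q) L` in `WeylLoc`. -/
instance : MulSemiringAction (Multiplicative ℕ) QMq :=
  MulSemiringAction.compHom QMq (powersHom (QMq →+* QMq) shift)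

/-- The localized `q`-Weyl algebra `ℚ(M, q)⟨L⟩ / (L f(M, q) - f(q M, q) L)`. -/
abbrev WeylLoc : Type := SkewPolynomial QMq

/-- A sorted operator as an element of the localized `q`-Weyl algebra. -/
def toWeylLoc (P : SortedOperator) : WeylLoc :=
  P.sum fun i a => SkewPolynomial.monomial i (algebraMap ZMq QMq a)

/-- The action of an operator on sequences: `(M f)_n = q ^ n f_n`, `(L f)_n = f_{n+1}`. -/
def act {F : Type*} [Field F] (q : F) (P : SortedOperator) (f : ℕ → F) (n : ℕ) : F :=
  P.sum fun i a =>
    a.eval₂ (Polynomial.eval₂RingHom (Int.castRingHom F) q) (q ^ n) * f (n + i)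

/-- The elements of `WeylLoc` that annihilate `f`: those that, after multiplication from the left by
some nonzero `d(M, q) ∈ ℤ[M, q]` that clears the denominators, annihilate `f`. -/
def annihilatorSet {F : Type*} [Field F] (q : F) (f : ℕ → F) : Set WeylLoc :=
  {P | ∃ (d : ZMq) (Q : SortedOperator), d ≠ 0 ∧
    toWeylLoc Q = SkewPolynomial.C (algebraMap ZMq QMq d) * P ∧ ∀ n, act q Q f n = 0}

/-- The operator is reduced: the greatest common divisor of its coefficients in `ℤ[M, q]` is `1`. -/
def IsReduced (P : SortedOperator) : Prop :=
  ∀ d : ZMq, (∀ i, d ∣ P.coeff i) → IsUnit d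

/-- `P` is the (homogeneous) annihilator of the sequence `f`: it is reduced and a left multiple, by a
nonzero element of `ℤ[M, q]`, of a monic operator that generates the left ideal of all annihilating
elements of the localized `q`-Weyl algebra. It is unique up to sign. -/
def IsAnnihilator {F : Type*} [Field F] (q : F) (f : ℕ → F) (P : SortedOperator) : Prop :=
  IsReduced P ∧ ∃ (P' : WeylLoc) (c : ZMq),
    (∃ d : ℕ, SkewPolynomial.coeff P' d = 1 ∧ ∀ i > d, SkewPolynomial.coeff P' i = 0) ∧
    ((Ideal.span {P'} : Ideal WeylLoc) : Set WeylLoc) = annihilatorSet q f ∧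
    c ≠ 0 ∧ toWeylLoc P = SkewPolynomial.C (algebraMap ZMq QMq c) * P'

/-- `P = A_K(M, L, q)` is the non-commutative `A`-polynomial of the knot `K`. -/
def IsNoncommutativeAPolynomial (K : KnotDiagram) (P : SortedOperator) : Prop :=
  IsAnnihilator qVar K.coloredJones P

/-! ### The knot group, its peripheral elements, and the `A`-polynomial -/

namespace GaussDiagram

variable (G : GaussDiagram)

/-- The letter `x_o ^ ε` that is contributed by passage `p` when it is a lower passage, through a
crossing of sign `ε` with upper strand `o`, and `1` when it is an upper passage. The generator `x_p`
is the loop from the eye of the observer that passes from right to left below the edge that enters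
passage `p`; loops are composed from left to right. -/
def undercrossing (p : Fin (2 * G.n)) : FreeGroup (Fin (2 * G.n)) :=
  match G.passage p with
  | (_, true) => 1
  | (k, false) => FreeGroup.of (G.upper k) ^ (G.sign k : ℤ)

/-- The Wirtinger relators: the edge `p` that enters a passage and the edge `next p` that leaves it
satisfy `x_p = h x_{next p} h⁻¹`, where `h` is the letter of the passage. -/
def wirtinger : Set (FreeGroup (Fin (2 * G.n))) :=
  Set.range fun p => FreeGroup.of p *
    (G.undercrossing p * FreeGroup.of (G.next p) * (G.undercrossing p)⁻¹)⁻¹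

/-- The fundamental group of the complement of the knot. -/
abbrev KnotGroup : Type := PresentedGroup G.wirtinger

/-- The passage from which the walk along the knot starts. -/
def base : Fin (2 * G.n) := ⟨0, by have := G.n_pos; omega⟩

/-- The meridian of the edge that enters the first passage. -/
def meridian : G.KnotGroup := PresentedGroup.of G.base

/-- The longitude that commutes with the meridian: the product of the letters along the knot,
corrected by a power of the meridian so as to have linking number zero with the knot. -/
def longitude : G.KnotGroup :=
  PresentedGroup.mk G.wirtinger (List.ofFn G.undercrossing).prod * G.meridian ^ (-G.writhe)

/-- The pairs `z = (L, M)` of eigenvalues of the longitude and the meridian, on a common eigenvector,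
for the representations of the knot group in `SL(2, ℂ)`. -/
def eigenvalueSet : Set (Fin 2 → ℂ) :=
  {z | ∃ (ρ : G.KnotGroup →* Matrix.SpecialLinearGroup (Fin 2) ℂ) (v : Fin 2 → ℂ), v ≠ 0 ∧
    Matrix.mulVec (ρ G.longitude : Matrix (Fin 2) (Fin 2) ℂ) v = z 0 • v ∧
    Matrix.mulVec (ρ G.meridian : Matrix (Fin 2) (Fin 2) ℂ) v = z 1 • v}

end GaussDiagram

/-- The Zariski closure in `ℂ²`. -/
def zariskiClosure (S : Set (Fin 2 → ℂ)) : Set (Fin 2 → ℂ) :=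
  {z | ∀ g : MvPolynomial (Fin 2) ℂ, (∀ w ∈ S, MvPolynomial.eval w g = 0) →
    MvPolynomial.eval z g = 0}

/-- `A = A_K(M, L)` is the `A`-polynomial of the knot `K`; variable `0` is `L` and variable `1` is
`M`. It is the primitive integral polynomial without repeated factors and without monomial factors
whose zero set in `(ℂ \ 0)²` is the union of the curves contained in the Zariski closure of the set
of eigenvalue pairs. This determines it up to sign. The factor `L - 1` of the reducible
representations is included. -/
def IsAPolynomial (K : KnotDiagram) (A : MvPolynomial (Fin 2) ℤ) : Prop :=
  (∀ c : ℤ, MvPolynomial.C c ∣ A → IsUnit c) ∧ Squarefree A ∧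
  ¬ MvPolynomial.X 0 ∣ A ∧ ¬ MvPolynomial.X 1 ∣ A ∧
  ∀ F : MvPolynomial (Fin 2) ℂ, Irreducible F → ¬ F ∣ MvPolynomial.X 0 → ¬ F ∣ MvPolynomial.X 1 →
    (F ∣ MvPolynomial.map (Int.castRingHom ℂ) A ↔
      ∀ z : Fin 2 → ℂ, z 0 ≠ 0 → z 1 ≠ 0 → MvPolynomial.eval z F = 0 →
        z ∈ zariskiClosure K.eigenvalueSet)

/-! ### Newton polytopes; the classical limit -/

/-- The plane with coordinates `(L, M)`, or `(x, y)`. -/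
abbrev Plane : Type := EuclideanSpace ℝ (Fin 2)

/-- Polynomials in rational powers of `L` and `M` with integer coefficients; the index `(a, b)` is
the exponent of `L ^ a M ^ b`. -/
abbrev FracPoly : Type := AddMonoidAlgebra ℤ (ℚ × ℚ)

/-- The monomial `L ^ a M ^ b`. -/
def mono (a b : ℚ) : FracPoly := AddMonoidAlgebra.single (a, b) 1

/-- `P(M, L, 1)`. -/
def atQOne (P : SortedOperator) : FracPoly :=
  P.eval₂ (Polynomial.eval₂RingHom (Polynomial.eval₂RingHom (Int.castRingHom FracPoly) 1)
    (mono 0 1)) (mono 1 0)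

/-- `A(M ^ (1/2), L)`. -/
def halfPower (A : MvPolynomial (Fin 2) ℤ) : FracPoly :=
  MvPolynomial.aeval ![mono 1 0, mono 0 (1 / 2)] A

/-- `B(M)`. -/
def inM (B : Polynomial ℤ) : FracPoly := Polynomial.aeval (mono 0 1) B

/-- The relation of the AJ Conjecture: `P(M, L, 1) = B(M) A(M ^ (1/2), L)`. -/
def AJRelation (P : SortedOperator) (A : MvPolynomial (Fin 2) ℤ) (B : Polynomial ℤ) : Prop :=
  atQOne P = inM B * halfPower A

/-- The Newton polygon in the `(L, M)`-plane. -/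
def newtonPolygon (f : FracPoly) : Set Plane :=
  convexHull ℝ {p | ∃ e : ℚ × ℚ, f.coeff e ≠ 0 ∧ p = !₂[(e.1 : ℝ), (e.2 : ℝ)]}

/-- The set of all `(i, j, k)` such that the monomial `q ^ k M ^ j L ^ i` occurs in `P`. -/
def exponents (P : SortedOperator) : Set (ℕ × ℕ × ℕ) :=
  {e | ((P.coeff e.1).coeff e.2.1).coeff e.2.2 ≠ 0}

/-- The three-dimensional Newton polytope `N_P`, with coordinates `(L, M, q)`. -/
def newtonPolytope (P : SortedOperator) : Set (EuclideanSpace ℝ (Fin 3)) :=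
  convexHull ℝ {p | ∃ e ∈ exponents P, p = !₂[(e.1 : ℝ), (e.2.1 : ℝ), (e.2.2 : ℝ)]}

/-- The projection to the `(L, M)`-plane. -/
def proj (p : EuclideanSpace ℝ (Fin 3)) : Plane := !₂[p 0, p 1]

/-- `N_{P,0}`, the projection of the Newton polytope `N_P`. -/
def newtonPolygonZero (P : SortedOperator) : Set Plane := proj '' newtonPolytope P

/-- `N_{P,1}`, the Newton polygon of `P(M, L, 1)`. -/
def newtonPolygonOne (P : SortedOperator) : Set Plane := newtonPolygon (atQOne P)

/-- `P` is good. -/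
def IsGood (P : SortedOperator) : Prop := newtonPolygonOne P = newtonPolygonZero P

/-! ### Tropical curve, Newton subdivision, duality -/

/-- The linear function `i x + j y - k` of the monomial `q ^ k M ^ j L ^ i`; here `q = 1 / t`. -/
def tropTerm (e : ℕ × ℕ × ℕ) (w : Plane) : ℝ := e.1 * w 0 + e.2.1 * w 1 - e.2.2

/-- The tropical curve `Γ_P`: the points where the minimum of the `i x + j y - k` over the exponents
of `P` is attained at least twice. -/
def tropicalCurve (P : SortedOperator) : Set Plane :=
  {w | ∃ e ∈ exponents P, ∃ e' ∈ exponents P, e ≠ e' ∧ tropTerm e w = tropTerm e' w ∧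
    ∀ e'' ∈ exponents P, tropTerm e w ≤ tropTerm e'' w}

/-- The lower face of `N_P` with normal direction `(w, 1)`, lower with respect to the exponent of
`t = 1 / q` (which is minus the exponent of `q`). -/
def lowerFace (P : SortedOperator) (w : Plane) : Set (EuclideanSpace ℝ (Fin 3)) :=
  {p ∈ newtonPolytope P | ∀ p' ∈ newtonPolytope P,
    p 0 * w 0 + p 1 * w 1 - p 2 ≤ p' 0 * w 0 + p' 1 * w 1 - p' 2}

/-- The Newton subdivision: the set of the projections of the lower faces of `N_P`. -/
def newtonSubdivision (P : SortedOperator) : Set (Set Plane) :=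
  Set.range fun w => proj '' lowerFace P w

/-- A finite collection of nonempty sets (cells) that contains the faces of its members, and in which
two members that meet, meet in a common face. -/
structure IsCellComplex (𝒞 : Set (Set Plane)) : Prop where
  finite : 𝒞.Finite
  nonempty : ∀ C ∈ 𝒞, C.Nonempty
  face : ∀ C ∈ 𝒞, ∀ F : Set Plane, F.Nonempty → IsExposed ℝ C F → F ∈ 𝒞
  inter : ∀ C ∈ 𝒞, ∀ D ∈ 𝒞, (C ∩ D).Nonempty → IsExposed ℝ C (C ∩ D) ∧ IsExposed ℝ D (C ∩ D)

/-- `𝒮` is a subdivision of `N` into polygons, segments and points. -/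
structure IsSubdivision (𝒮 : Set (Set Plane)) (N : Set Plane) : Prop where
  complex : IsCellComplex 𝒮
  polytope : ∀ S ∈ 𝒮, ∃ V : Finset Plane, S = convexHull ℝ (V : Set Plane)
  cover : ⋃₀ 𝒮 = N

/-- `𝒞` is a decomposition of the plane into (possibly unbounded) convex polyhedra. -/
structure IsPlaneDecomposition (𝒞 : Set (Set Plane)) : Prop where
  complex : IsCellComplex 𝒞
  polyhedron : ∀ C ∈ 𝒞, ∃ H : Finset (Plane × ℝ), C = {w | ∀ h ∈ H, inner ℝ h.1 w ≤ h.2}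
  cover : ⋃₀ 𝒞 = Set.univ

/-- The dimension of a cell. -/
def cellDim (C : Set Plane) : ℕ := Module.finrank ℝ (vectorSpan ℝ C)

/-- The curve `Γ` is dual to the subdivision `𝒮` of `N`: `Γ` is the union of the vertices and edges
(segments, rays or lines) of a polyhedral decomposition `𝒞` of the plane, and there is an
inclusion-reversing bijection from the cells of `𝒞` to the cells of `𝒮`, under which the dimensions
add up to `2` (vertices of `Γ` correspond to polygons, edges of `Γ` to edges, regions of the
complement of `Γ` to vertices), corresponding cells are perpendicular, and the unbounded cells
correspond to the cells on the boundary of `N`. Moreover the directions match (with the minimum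
convention): moving in the plane of `Γ` in some direction, the corresponding cells move
backwards; so the rays of `Γ` point in the direction of the inner normals of `N`. -/
def IsDual (Γ : Set Plane) (𝒮 : Set (Set Plane)) (N : Set Plane) : Prop :=
  ∃ 𝒞 : Set (Set Plane), IsPlaneDecomposition 𝒞 ∧
    Γ = ⋃₀ {C ∈ 𝒞 | cellDim C ≤ 1} ∧
    ∃ φ : 𝒞 ≃ 𝒮,
      (∀ C D : 𝒞, (C : Set Plane) ⊆ D ↔ (φ D : Set Plane) ⊆ φ C) ∧
      (∀ C : 𝒞, cellDim C + cellDim (φ C) = 2) ∧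
      (∀ C : 𝒞, ∀ u ∈ (C : Set Plane), ∀ v ∈ (C : Set Plane), ∀ p ∈ (φ C : Set Plane),
        ∀ p' ∈ (φ C : Set Plane), inner ℝ (u - v) (p - p') = 0) ∧
      (∀ C : 𝒞, ¬ Bornology.IsBounded (C : Set Plane) ↔ (φ C : Set Plane) ⊆ frontier N) ∧
      (∀ C D : 𝒞, ∀ u ∈ (C : Set Plane), ∀ v ∈ (D : Set Plane), ∀ p ∈ (φ C : Set Plane),
        ∀ p' ∈ (φ D : Set Plane), inner ℝ (u - v) (p - p') ≤ 0)

end TropicalKnot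

end

open TropicalKnot

/-!
The identity `N_{P,0} = N` is goodness read through the AJ relation. Since `P` is reduced it is not
zero, so its polygon is not empty and `B` is not zero. Newton polygons turn products into Minkowski
sums (`newtonPolygon_mul`), and the Newton polygon of a polynomial in `M` alone is a vertical segment
(`newtonPolygon_inM`).

The remaining part is the duality between a tropical plane curve and its regular subdivision, which
holds for every `P ≠ 0`. Both sides are indexed by the slopes `w` of the plane, through the set
`minSet P w` of the terms of the tropical polynomial that are minimal at `w`:

* the cell `subCell P w` of the subdivision is the convex hull of the exponents in `minSet P w`
  (`subCell_eq`), and it determines `minSet P w`, because a point of the polygon has at most one lift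
  to a lower face (`eq_of_proj_eq`, `subCell_subset_iff`);
* the cell `dualCell P w` of the plane consists of the `u` with `minSet P w ⊆ minSet P u`.

So inclusions of cells on both sides correspond to inclusions of the sets `minSet P w`, in opposite
directions, which gives the inclusion-reversing bijection. Monotonicity and perpendicularity come from
adding the inequalities that say that two lower faces are minimal for their own slopes
(`inner_sub_sub_nonpos`). That a small perturbation of the slope makes no further terms minimal
(`eventually_minSet_subset`) shows that faces of cells are cells and that the directions of dual cells
are orthogonal complements (`vectorSpan_dualCell`). The subdivision covers the polygon by a penalized
minimization over the polytope (`newtonSubdivision_cover`), and the unbounded cells are found with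
supporting functionals of the polygon (`not_isBounded_dualCell_iff`).
-/

noncomputable section

namespace TropicalKnot

/-! ### Convex geometry -/

/-- The face of a convex hull on which a linear functional is minimal is spanned by the generators on
which it is minimal. -/
theorem argmin_convexHull {E : Type*} [AddCommGroup E] [Module ℝ E] (V : Set E) (l : E →ₗ[ℝ] ℝ) :
    {x ∈ convexHull ℝ V | ∀ y ∈ convexHull ℝ V, l x ≤ l y} =
      convexHull ℝ {v ∈ V | ∀ v' ∈ V, l v ≤ l v'} := by
  apply Set.Subset.antisymm
  · rintro x ⟨hx, hmin⟩
    obtain ⟨ι, _, c, z, hc, hc1, hz, rfl⟩ := mem_convexHull_iff_exists_fintype.mp hx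
    set x := ∑ i, c i • z i with hxdef
    have hle : ∀ i, 0 ≤ c i * (l (z i) - l x) := fun i =>
      mul_nonneg (hc i) (sub_nonneg.mpr (hmin _ (subset_convexHull ℝ V (hz i))))
    have hsum : ∑ i, c i * (l (z i) - l x) = 0 := by
      have h1 : l x = ∑ i, c i * l (z i) := by simp [hxdef, map_sum]
      simp only [mul_sub, Finset.sum_sub_distrib, ← Finset.sum_mul, hc1, one_mul]
      linarith
    have hzero : ∀ i, c i * (l (z i) - l x) = 0 := fun i =>
      (Finset.sum_eq_zero_iff_of_nonneg fun i _ => hle i).mp hsum i (Finset.mem_univ i)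
    have hsupp : ∀ i, c i ≠ 0 → z i ∈ {v ∈ V | ∀ v' ∈ V, l v ≤ l v'} := fun i hi => by
      refine ⟨hz i, fun v' hv' => ?_⟩
      have h2 := (mul_eq_zero.mp (hzero i)).resolve_left hi
      have := hmin _ (subset_convexHull ℝ V hv')
      linarith
    rw [hxdef, ← Finset.sum_filter_of_ne (p := fun i => c i ≠ 0)
      (fun i _ h h0 => h (by rw [h0, zero_smul]))]
    refine (convex_convexHull ℝ _).sum_mem (fun i _ => hc i) ?_
      (fun i hi => subset_convexHull ℝ _ (hsupp i (Finset.mem_filter.mp hi).2))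
    rw [Finset.sum_filter_ne_zero, hc1]
  · refine convexHull_min (fun v hv => ⟨subset_convexHull ℝ V hv.1, fun y hy => ?_⟩) ?_
    · exact convexHull_min hv.2 (convex_halfSpace_ge l.isLinear (l v)) hy
    · rintro x ⟨hx, hxm⟩ y ⟨hy, hym⟩ a b ha hb hab
      refine ⟨convex_convexHull ℝ V hx hy ha hb hab, fun u hu => ?_⟩
      have h1 := mul_le_mul_of_nonneg_left (hxm u hu) ha
      have h2 := mul_le_mul_of_nonneg_left (hym u hu) hb
      have h3 : l u = a * l u + b * l u := by rw [← add_mul, hab, one_mul]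
      simp only [map_add, map_smul, smul_eq_mul]
      linarith

/-- A convex set has a supporting functional at each of its points that is not interior. -/
theorem exists_supporting {E : Type*} [NormedAddCommGroup E] [InnerProductSpace ℝ E]
    [FiniteDimensional ℝ E] {N : Set E} (hN : Convex ℝ N) {c : E} (hc : c ∈ N)
    (hci : c ∉ interior N) : ∃ d : E, d ≠ 0 ∧ ∀ y ∈ N, inner ℝ d c ≤ inner ℝ d y := by
  by_cases hne : (interior N).Nonempty
  · obtain ⟨f, hf⟩ := geometric_hahn_banach_point_open hN.interior isOpen_interior hci
    refine ⟨(InnerProductSpace.toDual ℝ E).symm f, fun h0 => ?_, fun y hy => ?_⟩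
    · obtain ⟨b, hb⟩ := hne
      have := hf b hb
      rw [LinearIsometryEquiv.map_eq_zero_iff] at h0
      simp [h0] at this
    · simp only [InnerProductSpace.toDual_symm_apply]
      have hy' : y ∈ closure (interior N) := by
        rw [hN.closure_interior_eq_closure_of_nonempty_interior hne]
        exact subset_closure hy
      exact closure_minimal (fun b hb => (hf b hb).le) (isClosed_le continuous_const f.continuous) hy'
  · have hspan : vectorSpan ℝ N ≠ ⊤ := fun h =>
      hne (hN.interior_nonempty_iff_affineSpan_eq_top.mpr
        ((AffineSubspace.affineSpan_eq_top_iff_vectorSpan_eq_top_of_nonempty ℝ E E ⟨c, hc⟩).mpr h))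
    have horth : (vectorSpan ℝ N)ᗮ ≠ ⊥ := fun h => hspan (by
      rwa [Submodule.orthogonal_eq_bot_iff] at h)
    obtain ⟨d, hd, hd0⟩ := Submodule.exists_mem_ne_zero_of_ne_bot horth
    refine ⟨d, hd0, fun y hy => ?_⟩
    have h := Submodule.inner_left_of_mem_orthogonal (vsub_mem_vectorSpan ℝ hy hc) hd
    rw [vsub_eq_sub, inner_sub_right] at h
    linarith

/-! ### Newton polygons of products -/

/-- The exponent `(a, b)` of `L ^ a M ^ b` as a point of the plane. -/
def expPoint : ℚ × ℚ →+ Plane where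
  toFun e := !₂[(e.1 : ℝ), (e.2 : ℝ)]
  map_zero' := by ext i; fin_cases i <;> simp
  map_add' e e' := by ext i; fin_cases i <;> simp

theorem expPoint_injective : Function.Injective expPoint := by
  intro e e' h
  have h0 := congrArg (fun p : Plane => p 0) h
  have h1 := congrArg (fun p : Plane => p 1) h
  simp [expPoint] at h0 h1
  exact Prod.ext h0 h1

theorem newtonPolygon_eq (f : FracPoly) :
    newtonPolygon f = convexHull ℝ (expPoint '' (f.coeff.support : Set (ℚ × ℚ))) := by
  refine congrArg _ (Set.ext fun p => ?_)
  simp [expPoint, eq_comm]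

/-- Newton polygons turn products into Minkowski sums: an extreme point of the sum has only one
decomposition into exponents of the factors, so there is no cancellation at it. -/
theorem newtonPolygon_mul (f g : FracPoly) :
    newtonPolygon (f * g) = newtonPolygon f + newtonPolygon g := by
  classical
  simp only [newtonPolygon_eq, ← convexHull_add]
  set S := expPoint '' (f.coeff.support : Set (ℚ × ℚ))
  set T := expPoint '' (g.coeff.support : Set (ℚ × ℚ))
  have hS : S.Finite := f.coeff.support.finite_toSet.image _
  have hT : T.Finite := g.coeff.support.finite_toSet.image _
  apply Set.Subset.antisymm
  · refine convexHull_mono ?_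
    rintro _ ⟨e, he, rfl⟩
    obtain ⟨a, ha, b, hb, rfl⟩ := Finset.mem_add.mp (AddMonoidAlgebra.support_coeff_mul_subset f g he)
    exact ⟨_, ⟨a, ha, rfl⟩, _, ⟨b, hb, rfl⟩, (map_add expPoint a b).symm⟩
  · rw [← closure_convexHull_extremePoints ((hS.add hT).isCompact_convexHull ℝ)
      (convex_convexHull ℝ _)]
    refine closure_minimal (convexHull_mono fun x hx => ?_)
      (((f * g).coeff.support.finite_toSet.image expPoint).isCompact_convexHull ℝ).isClosed
    obtain ⟨_, ⟨a, ha, rfl⟩, _, ⟨b, hb, rfl⟩, hab⟩ := Set.mem_add.mp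
      (extremePoints_convexHull_subset hx)
    have huniq : UniqueAdd f.coeff.support g.coeff.support a b := by
      intro a' b' ha' hb' h
      have hsum : expPoint a' + expPoint b' = expPoint a + expPoint b := by
        rw [← map_add, ← map_add, h]
      -- `x` is the midpoint of the two mixed sums
      have hmid : x ∈ openSegment ℝ (expPoint a + expPoint b') (expPoint a' + expPoint b) := by
        refine ⟨1 / 2, 1 / 2, by norm_num, by norm_num, by norm_num, ?_⟩
        rw [← smul_add, ← hab, show expPoint a + expPoint b' + (expPoint a' + expPoint b) =
          (expPoint a' + expPoint b') + (expPoint a + expPoint b) by abel, hsum, ← two_smul ℝ,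
          smul_smul]
        norm_num
      have hx' := (mem_extremePoints_iff_left.mp hx).2 _
        (subset_convexHull ℝ _ (Set.add_mem_add ⟨a, ha, rfl⟩ ⟨b', hb', rfl⟩)) _
        (subset_convexHull ℝ _ (Set.add_mem_add ⟨a', ha', rfl⟩ ⟨b, hb, rfl⟩)) hmid
      rw [← hab] at hx'
      have hb'' := expPoint_injective (add_left_cancel hx')
      rw [hb''] at h
      exact ⟨add_right_cancel h, hb''⟩
    refine ⟨a + b, ?_, by rw [map_add, ← hab]⟩
    simp only [Finset.mem_coe, Finsupp.mem_support_iff] at ha hb ⊢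
    rw [AddMonoidAlgebra.coeff_mul_add_of_uniqueAdd huniq]
    exact mul_ne_zero ha hb

theorem newtonPolygon_nonempty {f : FracPoly} : (newtonPolygon f).Nonempty ↔ f ≠ 0 := by
  rw [newtonPolygon_eq, convexHull_nonempty_iff, Set.image_nonempty, Finset.coe_nonempty,
    Finsupp.support_nonempty_iff, Ne, AddMonoidAlgebra.coeff_eq_zero]

theorem coeff_inM (B : Polynomial ℤ) (e : ℚ × ℚ) :
    (inM B).coeff e ≠ 0 ↔ ∃ n : ℕ, B.coeff n ≠ 0 ∧ e = (0, (n : ℚ)) := by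
  classical
  have h : (inM B).coeff e = ∑ n ∈ Finset.range (B.natDegree + 1),
      if ((0, (n : ℚ)) : ℚ × ℚ) = e then B.coeff n else 0 := by
    rw [inM, Polynomial.aeval_eq_sum_range, AddMonoidAlgebra.coeff_sum, Finsupp.finsetSum_apply]
    refine Finset.sum_congr rfl fun n _ => ?_
    simp [mono, AddMonoidAlgebra.single_pow, Finsupp.single_apply]
  rw [h]
  constructor
  · intro hne
    obtain ⟨n, -, hn⟩ := Finset.exists_ne_zero_of_sum_ne_zero hne
    have hn' := ite_ne_right_iff.mp hn
    exact ⟨n, hn'.2, hn'.1.symm⟩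
  · rintro ⟨n, hn, rfl⟩
    rw [Finset.sum_eq_single_of_mem n (Finset.mem_range_succ_iff.mpr
      (Polynomial.le_natDegree_of_ne_zero hn)) fun m _ hm => if_neg fun h0 => hm (by simpa using h0),
      if_pos rfl]
    exact hn

/-- The Newton polygon of a polynomial in `M` alone is a vertical segment. -/
theorem newtonPolygon_inM {B : Polynomial ℤ} (hB : B ≠ 0) :
    newtonPolygon (inM B) =
      segment ℝ (!₂[0, (B.natTrailingDegree : ℝ)] : Plane) !₂[0, (B.natDegree : ℝ)] := by
  have hset : {p : Plane | ∃ e : ℚ × ℚ, (inM B).coeff e ≠ 0 ∧ p = !₂[(e.1 : ℝ), (e.2 : ℝ)]} =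
      {p | ∃ n : ℕ, B.coeff n ≠ 0 ∧ p = !₂[0, (n : ℝ)]} := by
    ext p
    simp only [coeff_inM, Set.mem_ofPred_eq]
    constructor
    · rintro ⟨_, ⟨n, hn, rfl⟩, rfl⟩
      exact ⟨n, hn, by simp⟩
    · rintro ⟨n, hn, rfl⟩
      exact ⟨_, ⟨n, hn, rfl⟩, by simp⟩
  rw [newtonPolygon, hset]
  apply Set.Subset.antisymm
  · refine convexHull_min ?_ (convex_segment _ _)
    rintro _ ⟨n, hn, rfl⟩
    have h1 : (B.natTrailingDegree : ℝ) ≤ n := by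
      exact_mod_cast Polynomial.natTrailingDegree_le_of_ne_zero hn
    have h2 : (n : ℝ) ≤ B.natDegree := by exact_mod_cast Polynomial.le_natDegree_of_ne_zero hn
    have h3 : (n : ℝ) ∈ segment ℝ (B.natTrailingDegree : ℝ) B.natDegree := by
      rw [segment_eq_Icc (h1.trans h2)]
      exact ⟨h1, h2⟩
    obtain ⟨a, b, ha, hb, hab, h⟩ := h3
    refine ⟨a, b, ha, hb, hab, ?_⟩
    ext i
    fin_cases i
    · simp
    · simpa using h
  · refine (convex_convexHull ℝ _).segment_subset (subset_convexHull ℝ _ ⟨_, ?_, rfl⟩)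
      (subset_convexHull ℝ _ ⟨_, ?_, rfl⟩)
    · exact Polynomial.coeff_natTrailingDegree_ne_zero.mpr hB
    · exact Polynomial.coeff_natDegree (p := B) ▸ Polynomial.leadingCoeff_ne_zero.mpr hB

/-! ### Lower faces and their projections -/

/-- The linear functional that is minimal on the lower face with normal direction `(w, 1)`. -/
def tilt (w : Plane) : EuclideanSpace ℝ (Fin 3) →ₗ[ℝ] ℝ where
  toFun p := p 0 * w 0 + p 1 * w 1 - p 2
  map_add' p p' := by simp; ring
  map_smul' c p := by simp; ring

/-- The projection to the `(L, M)`-plane as a linear map. -/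
def projLin : EuclideanSpace ℝ (Fin 3) →ₗ[ℝ] Plane where
  toFun := proj
  map_add' p p' := by ext i; fin_cases i <;> simp [proj]
  map_smul' c p := by ext i; fin_cases i <;> simp [proj]

/-- The exponent of a monomial as a vertex of the three-dimensional polytope. -/
def liftPoint (e : ℕ × ℕ × ℕ) : EuclideanSpace ℝ (Fin 3) := !₂[(e.1 : ℝ), (e.2.1 : ℝ), (e.2.2 : ℝ)]

/-- The exponent of a monomial, projected to the `(L, M)`-plane. -/
def planePoint (e : ℕ × ℕ × ℕ) : Plane := !₂[(e.1 : ℝ), (e.2.1 : ℝ)]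

theorem proj_liftPoint (e : ℕ × ℕ × ℕ) : proj (liftPoint e) = planePoint e := by
  simp [proj, liftPoint, planePoint]

theorem plane_inner (x y : Plane) : inner ℝ x y = x 0 * y 0 + x 1 * y 1 := by
  simp [PiLp.inner_apply, Fin.sum_univ_two, mul_comm]

theorem tilt_eq (w : Plane) (p : EuclideanSpace ℝ (Fin 3)) :
    tilt w p = inner ℝ (proj p) w - p 2 := by
  simp [tilt, plane_inner, proj]

theorem tropTerm_eq (e : ℕ × ℕ × ℕ) (w : Plane) :
    tropTerm e w = inner ℝ (planePoint e) w - e.2.2 := by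
  simp [tropTerm, plane_inner, planePoint]

theorem tilt_liftPoint (w : Plane) (e : ℕ × ℕ × ℕ) : tilt w (liftPoint e) = tropTerm e w := by
  rw [tilt_eq, tropTerm_eq, proj_liftPoint]
  simp [liftPoint]

/-- Terms of the tropical polynomial with the same slope and the same value somewhere coincide. -/
theorem eq_of_planePoint_eq {e e' : ℕ × ℕ × ℕ} {w : Plane} (h : planePoint e = planePoint e')
    (hw : tropTerm e w = tropTerm e' w) : e = e' := by
  have h0 := congrArg (fun p : Plane => p 0) h
  have h1 := congrArg (fun p : Plane => p 1) h
  simp only [tropTerm_eq, h] at hw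
  have h2 : (e.2.2 : ℝ) = e'.2.2 := by linarith
  simp [planePoint] at h0 h1
  exact Prod.ext h0 (Prod.ext h1 (by exact_mod_cast h2))

variable (P : SortedOperator)

/-- The monomials of `P` whose term attains the tropical minimum at `w`. -/
def minSet (w : Plane) : Set (ℕ × ℕ × ℕ) :=
  {e ∈ exponents P | ∀ e' ∈ exponents P, tropTerm e w ≤ tropTerm e' w}

/-- The cell of the Newton subdivision that is the projection of the lower face with normal
direction `(w, 1)`. -/
def subCell (w : Plane) : Set Plane := proj '' lowerFace P w

theorem exponents_finite : (exponents P).Finite := by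
  have h : exponents P ⊆ ⋃ i ∈ P.support, ⋃ j ∈ (P.coeff i).support,
      (fun k => (i, j, k)) '' (((P.coeff i).coeff j).support : Set ℕ) := by
    rintro ⟨i, j, k⟩ h
    have h1 : (((P.coeff i).coeff j).coeff k) ≠ 0 := h
    have h2 : (P.coeff i).coeff j ≠ 0 := fun h0 => h1 (by simp [h0])
    have h3 : P.coeff i ≠ 0 := fun h0 => h2 (by simp [h0])
    simp only [Set.mem_iUnion, Polynomial.mem_support_iff]
    exact ⟨i, h3, j, h2, k, by simpa using h1, rfl⟩
  exact (P.support.finite_toSet.biUnion fun i _ => (P.coeff i).support.finite_toSet.biUnion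
    fun j _ => ((P.coeff i).coeff j).support.finite_toSet.image _).subset h

theorem newtonPolytope_eq : newtonPolytope P = convexHull ℝ (liftPoint '' exponents P) := by
  refine congrArg _ (Set.ext fun p => ?_)
  simp only [liftPoint, Set.mem_image, Set.mem_ofPred_eq, eq_comm]

theorem newtonPolytope_isCompact : IsCompact (newtonPolytope P) := by
  rw [newtonPolytope_eq]
  exact ((exponents_finite P).image _).isCompact_convexHull ℝ

theorem newtonPolytope_convex : Convex ℝ (newtonPolytope P) := convex_convexHull ℝ _

theorem newtonPolygonZero_eq :
    newtonPolygonZero P = convexHull ℝ (planePoint '' exponents P) := by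
  rw [newtonPolygonZero, newtonPolytope_eq]
  refine (projLin.image_convexHull _).trans ?_
  rw [Set.image_image]
  exact congrArg _ (Set.image_congr fun e _ => proj_liftPoint e)

/-- A lower face is spanned by the exponents of the terms that are minimal at its slope. -/
theorem lowerFace_eq (w : Plane) : lowerFace P w = convexHull ℝ (liftPoint '' minSet P w) := by
  have h := argmin_convexHull (liftPoint '' exponents P) (tilt w)
  rw [← newtonPolytope_eq] at h
  refine Eq.trans h (congrArg _ (Set.ext fun p => ?_))
  constructor
  · rintro ⟨⟨e, he, rfl⟩, hm⟩
    refine ⟨e, ⟨he, fun e' he' => ?_⟩, rfl⟩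
    simpa only [tilt_liftPoint] using hm _ ⟨e', he', rfl⟩
  · rintro ⟨e, he, rfl⟩
    refine ⟨⟨e, he.1, rfl⟩, ?_⟩
    rintro _ ⟨e', he', rfl⟩
    simpa only [tilt_liftPoint] using he.2 e' he'

theorem subCell_eq (w : Plane) : subCell P w = convexHull ℝ (planePoint '' minSet P w) := by
  rw [subCell, lowerFace_eq]
  refine (projLin.image_convexHull _).trans ?_
  rw [Set.image_image]
  exact congrArg _ (Set.image_congr fun e _ => proj_liftPoint e)

theorem minSet_finite (w : Plane) : (minSet P w).Finite :=
  (exponents_finite P).subset fun _ h => h.1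

theorem subCell_isCompact (w : Plane) : IsCompact (subCell P w) := by
  rw [subCell_eq]
  exact ((minSet_finite P w).image _).isCompact_convexHull ℝ

variable {P}

theorem mem_lowerFace_iff {w : Plane} {p : EuclideanSpace ℝ (Fin 3)} :
    p ∈ lowerFace P w ↔ p ∈ newtonPolytope P ∧ ∀ p' ∈ newtonPolytope P, tilt w p ≤ tilt w p' :=
  Iff.rfl

theorem exponents_nonempty (hP : P ≠ 0) : (exponents P).Nonempty := by
  by_contra h
  rw [Set.not_nonempty_iff_eq_empty] at h
  refine hP (Polynomial.ext fun i => Polynomial.ext fun j => Polynomial.ext fun k => ?_)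
  by_contra h0
  have : (i, j, k) ∈ exponents P := h0
  rwa [h] at this

theorem minSet_nonempty (hP : P ≠ 0) (w : Plane) : (minSet P w).Nonempty := by
  obtain ⟨e, he, hm⟩ := (exponents_finite P).exists_minimalFor (tropTerm · w) _
    (exponents_nonempty hP)
  refine ⟨e, he, fun e' he' => ?_⟩
  rcases le_total (tropTerm e w) (tropTerm e' w) with h | h
  · exact h
  · exact hm he' h

theorem planePoint_mem_subCell {w : Plane} {e : ℕ × ℕ × ℕ} (he : e ∈ minSet P w) :
    planePoint e ∈ subCell P w := by
  rw [subCell_eq]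
  exact subset_convexHull ℝ _ ⟨e, he, rfl⟩

theorem subCell_nonempty (hP : P ≠ 0) (w : Plane) : (subCell P w).Nonempty :=
  let ⟨_, he⟩ := minSet_nonempty hP w
  ⟨_, planePoint_mem_subCell he⟩

theorem subCell_subset (w : Plane) : subCell P w ⊆ newtonPolygonZero P :=
  Set.image_mono fun _ h => h.1

/-- Points of two lower faces with the same projection are equal, because each has the greatest
possible last coordinate. -/
theorem eq_of_proj_eq {w w' : Plane} {p p' : EuclideanSpace ℝ (Fin 3)} (hp : p ∈ lowerFace P w)
    (hp' : p' ∈ lowerFace P w') (h : proj p = proj p') : p = p' := by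
  rw [mem_lowerFace_iff] at hp hp'
  have h1 := hp.2 p' hp'.1
  have h2 := hp'.2 p hp.1
  simp only [tilt_eq, h] at h1 h2
  have h0 := congrArg (fun p : Plane => p 0) h
  have h01 := congrArg (fun p : Plane => p 1) h
  simp [proj] at h0 h01
  ext i
  fin_cases i
  · exact h0
  · exact h01
  · exact le_antisymm (by simp; linarith) (by simp; linarith)

theorem mem_minSet_iff {w : Plane} {e : ℕ × ℕ × ℕ} (he : e ∈ exponents P) :
    e ∈ minSet P w ↔ liftPoint e ∈ lowerFace P w := by
  constructor
  · intro h
    rw [lowerFace_eq]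
    exact subset_convexHull ℝ _ ⟨e, h, rfl⟩
  · refine fun h => ⟨he, fun e' he' => ?_⟩
    have := (mem_lowerFace_iff.mp h).2 (liftPoint e')
      (by rw [newtonPolytope_eq]; exact subset_convexHull ℝ _ ⟨e', he', rfl⟩)
    simpa only [tilt_liftPoint] using this

/-- A cell of the subdivision determines the terms that are minimal: its lift to the polytope is
unique. -/
theorem subCell_subset_iff {w w' : Plane} :
    subCell P w ⊆ subCell P w' ↔ minSet P w ⊆ minSet P w' := by
  constructor
  · intro h e he
    have hl := (mem_minSet_iff he.1).mp he
    obtain ⟨p, hp, hpe⟩ := h ⟨_, hl, rfl⟩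
    exact (mem_minSet_iff he.1).mpr (eq_of_proj_eq hp hl hpe ▸ hp)
  · intro h
    rw [subCell_eq, subCell_eq]
    exact convexHull_mono (Set.image_mono h)

/-- The monotonicity of the correspondence between slopes and lower faces: add the two inequalities
that express that each face is minimal for its own slope. -/
theorem inner_sub_sub_nonpos {u v p p' : Plane} (hp : p ∈ subCell P u) (hp' : p' ∈ subCell P v) :
    inner ℝ (u - v) (p - p') ≤ 0 := by
  obtain ⟨x, hx, rfl⟩ := hp
  obtain ⟨y, hy, rfl⟩ := hp'
  rw [mem_lowerFace_iff] at hx hy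
  have h1 := hx.2 y hy.1
  have h2 := hy.2 x hx.1
  simp only [tilt_eq] at h1 h2
  simp only [inner_sub_left, inner_sub_right]
  simp only [real_inner_comm u, real_inner_comm v] at h1 h2 ⊢
  linarith

/-- Cells of the Newton subdivision that meet, meet in a face. -/
theorem isExposed_subCell_inter {w w' : Plane} :
    IsExposed ℝ (subCell P w) (subCell P w ∩ subCell P w') := by
  rintro ⟨_, ⟨y, hy, rfl⟩, ⟨y', hy', hyy'⟩⟩
  obtain rfl := eq_of_proj_eq hy' hy hyy'
  have hy := mem_lowerFace_iff.mp hy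
  have hy' := mem_lowerFace_iff.mp hy'
  -- On the first lower face `tilt w` is constant, so there `tilt w'` is the linear function with
  -- gradient `w' - w` up to a constant; its minima are the points of the second lower face.
  refine ⟨innerSL ℝ (w - w'), Set.ext fun x => ?_⟩
  constructor
  · rintro ⟨⟨a, ha, rfl⟩, ⟨b, hb, hab⟩⟩
    obtain rfl := eq_of_proj_eq hb ha hab
    refine ⟨⟨b, ha, rfl⟩, ?_⟩
    rintro _ ⟨z, hz, rfl⟩
    have h1 := (mem_lowerFace_iff.mp hz).2 b hb.1
    have h2 := (mem_lowerFace_iff.mp hb).2 z hz.1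
    simp only [tilt_eq] at h1 h2
    simp only [innerSL_apply_apply, inner_sub_left]
    simp only [real_inner_comm w, real_inner_comm w'] at h1 h2 ⊢
    linarith
  · rintro ⟨⟨a, ha, rfl⟩, hmax⟩
    refine ⟨⟨a, ha, rfl⟩, ⟨a, ?_, rfl⟩⟩
    have h1 := hmax _ ⟨y', hy, rfl⟩
    have h2 := (mem_lowerFace_iff.mp ha).2 y' hy.1
    refine mem_lowerFace_iff.mpr ⟨ha.1, fun z hz => le_trans ?_ (hy'.2 z hz)⟩
    simp only [tilt_eq] at h2 ⊢
    simp only [innerSL_apply_apply, inner_sub_left] at h1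
    simp only [real_inner_comm w, real_inner_comm w'] at h1 h2 ⊢
    linarith

open Filter Topology

/-! ### Small perturbations of the slope -/

/-- A small perturbation of the slope makes no further terms minimal. -/
theorem eventually_minSet_subset (hP : P ≠ 0) (w : Plane) : ∀ᶠ u in 𝓝 w, minSet P u ⊆ minSet P w := by
  obtain ⟨e₀, he₀⟩ := minSet_nonempty hP w
  have h : ∀ᶠ u in 𝓝 w, ∀ e ∈ exponents P \ minSet P w, tropTerm e₀ u < tropTerm e u := by
    rw [Filter.eventually_all_finite ((exponents_finite P).subset Set.sdiff_subset)]
    rintro e ⟨he, hew⟩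
    have hlt : tropTerm e₀ w < tropTerm e w := by
      by_contra! hle
      exact hew ⟨he, fun e' he' => hle.trans (he₀.2 e' he')⟩
    have hcont : ∀ e, Continuous (tropTerm e) := fun e => by
      unfold tropTerm
      fun_prop
    exact (hcont e₀).continuousAt.eventually_lt (hcont e).continuousAt hlt
  filter_upwards [h] with u hu e he
  by_contra hew
  exact absurd (he.2 e₀ he₀.1) (not_le.mpr (hu e ⟨he.1, hew⟩))

theorem minSet_eq_of_subset (hP : P ≠ 0) {w u : Plane} (h : minSet P u ⊆ minSet P w) :
    minSet P u = {e ∈ minSet P w | ∀ e' ∈ minSet P w, tropTerm e u ≤ tropTerm e' u} := by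
  obtain ⟨e₀, he₀⟩ := minSet_nonempty hP u
  ext e
  exact ⟨fun he => ⟨h he, fun e' he' => he.2 e' he'.1⟩, fun he => ⟨he.1.1, fun e' he' =>
    (he.2 e₀ (h he₀)).trans (he₀.2 e' he')⟩⟩

theorem tropTerm_eq_of_mem {w : Plane} {e e' : ℕ × ℕ × ℕ} (he : e ∈ minSet P w)
    (he' : e' ∈ minSet P w) : tropTerm e w = tropTerm e' w :=
  le_antisymm (he.2 e' he'.1) (he'.2 e he.1)

theorem tropTerm_add_smul (e : ℕ × ℕ × ℕ) (w d : Plane) (t : ℝ) :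
    tropTerm e (w + t • d) = tropTerm e w + t * inner ℝ (planePoint e) d := by
  rw [tropTerm_eq, tropTerm_eq, inner_add_right, inner_smul_right]
  ring

/-- After a small step in the direction `d`, the minimal terms are those, among the terms minimal
before, that grow the least in this direction. -/
theorem eventually_minSet_line (hP : P ≠ 0) (w d : Plane) :
    ∀ᶠ t : ℝ in 𝓝[>] 0, minSet P (w + t • d) = {e ∈ minSet P w |
      ∀ e' ∈ minSet P w, inner ℝ (planePoint e) d ≤ inner ℝ (planePoint e') d} := by
  have hlim : Tendsto (fun t : ℝ => w + t • d) (𝓝[>] 0) (𝓝 w) := by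
    have : Tendsto (fun t : ℝ => w + t • d) (𝓝 0) (𝓝 (w + (0 : ℝ) • d)) :=
      (by fun_prop : Continuous fun t : ℝ => w + t • d).tendsto 0
    rw [zero_smul, add_zero] at this
    exact this.mono_left nhdsWithin_le_nhds
  filter_upwards [hlim.eventually (eventually_minSet_subset hP w), self_mem_nhdsWithin] with t ht ht0
  rw [minSet_eq_of_subset hP ht]
  ext e
  refine and_congr_right fun he => forall₂_congr fun e' he' => ?_
  rw [tropTerm_add_smul, tropTerm_add_smul, tropTerm_eq_of_mem he he', add_le_add_iff_left]
  exact mul_le_mul_iff_of_pos_left ht0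

theorem eventually_minSet_line_eq (hP : P ≠ 0) {w d : Plane}
    (hd : ∀ e ∈ minSet P w, ∀ e' ∈ minSet P w,
      inner ℝ (planePoint e) d = inner ℝ (planePoint e') d) :
    ∀ᶠ t : ℝ in 𝓝[>] 0, minSet P (w + t • d) = minSet P w := by
  filter_upwards [eventually_minSet_line hP w d] with t ht
  rw [ht]
  exact Set.sep_eq_self_iff_mem_true.mpr fun e he e' he' => (hd e he e' he').le

/-! ### The Newton subdivision -/

theorem newtonSubdivision_finite (P : SortedOperator) : (newtonSubdivision P).Finite := by
  refine ((exponents_finite P).finite_subsets.image fun F => convexHull ℝ (planePoint '' F)).subset ?_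
  rintro _ ⟨w, rfl⟩
  exact ⟨minSet P w, fun e he => he.1, (subCell_eq P w).symm⟩

/-- The faces of a cell of the Newton subdivision are cells. -/
theorem newtonSubdivision_face (hP : P ≠ 0) (w : Plane) {F : Set Plane} (hne : F.Nonempty)
    (hF : IsExposed ℝ (subCell P w) F) : F ∈ newtonSubdivision P := by
  obtain ⟨l, rfl⟩ := hF hne
  set d : Plane := (InnerProductSpace.toDual ℝ Plane).symm l
  have hl : ∀ x : Plane, l x = - inner ℝ x (-d) := fun x => by
    rw [inner_neg_right, neg_neg, real_inner_comm]
    exact (InnerProductSpace.toDual_symm_apply ..).symm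
  -- tilting the slope slightly against the functional cuts the face out of the cell
  obtain ⟨t, ht⟩ := (eventually_minSet_line hP w (-d)).exists
  refine ⟨w + t • -d, ?_⟩
  change subCell P _ = _
  have h := argmin_convexHull (planePoint '' minSet P w) ((-l : StrongDual ℝ Plane) : Plane →ₗ[ℝ] ℝ)
  rw [← subCell_eq] at h
  rw [subCell_eq, ht]
  refine Eq.trans (congrArg _ (Set.ext fun p => ?_)) (h.symm.trans ?_)
  · constructor
    · rintro ⟨e, ⟨he, hm⟩, rfl⟩
      refine ⟨⟨e, he, rfl⟩, ?_⟩
      rintro _ ⟨e', he', rfl⟩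
      simpa [hl] using hm e' he'
    · rintro ⟨⟨e, he, rfl⟩, hm⟩
      refine ⟨e, ⟨he, fun e' he' => ?_⟩, rfl⟩
      simpa [hl] using hm _ ⟨e', he', rfl⟩
  · ext x
    simp

/-- The cells of the Newton subdivision cover the polygon. For a point `p` of the polygon and
`δ > 0`, a minimum `(s, h)` of `‖s - p‖ ^ 2 - δ h` over the polytope lies on the lower face with slope
`2 (s - p) / δ`, and `s` tends to `p` as `δ` tends to `0`; the union of the cells is closed. -/
theorem newtonSubdivision_cover (P : SortedOperator) :
    ⋃₀ newtonSubdivision P = newtonPolygonZero P := by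
  apply Set.Subset.antisymm
  · rintro x ⟨_, ⟨w, rfl⟩, hx⟩
    exact subCell_subset w hx
  have hclosed : IsClosed (⋃₀ newtonSubdivision P) := by
    rw [Set.sUnion_eq_biUnion]
    refine (newtonSubdivision_finite P).isClosed_biUnion ?_
    rintro _ ⟨w, rfl⟩
    exact (subCell_isCompact P w).isClosed
  rintro _ ⟨a, ha, rfl⟩
  obtain ⟨H, hH⟩ := (newtonPolytope_isCompact P).isBounded.exists_norm_le
  have hH2 : ∀ y ∈ newtonPolytope P, |y 2| ≤ H := fun y hy =>
    (PiLp.norm_apply_le y 2).trans (hH y hy)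
  rw [← hclosed.closure_eq, Metric.mem_closure_iff]
  intro ε hε
  have hH0 : 0 ≤ H := (norm_nonneg a).trans (hH a ha)
  set δ : ℝ := ε ^ 2 / (2 * H + 1)
  have hδ : 0 < δ := by positivity
  have hproj : Continuous proj := projLin.continuous_of_finiteDimensional
  obtain ⟨y, hy, hmin⟩ := (newtonPolytope_isCompact P).exists_isMinOn ⟨a, ha⟩
    (f := fun y => ‖proj y - proj a‖ ^ 2 - δ * y 2) (by fun_prop)
  set w : Plane := (2 / δ) • (proj y - proj a)
  refine ⟨proj y, ⟨subCell P w, ⟨w, rfl⟩, ⟨y, mem_lowerFace_iff.mpr ⟨hy, fun z hz => ?_⟩, rfl⟩⟩, ?_⟩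
  · -- the first-order condition at the minimum, in the direction of `z`
    have hfirst : ∀ θ ∈ Set.Ioc (0 : ℝ) 1, 0 ≤ 2 * inner ℝ (proj y - proj a) (proj z - proj y)
        - δ * (z 2 - y 2) + θ * ‖proj z - proj y‖ ^ 2 := by
      intro θ hθ
      have hmem := newtonPolytope_convex P hy hz (sub_nonneg.mpr hθ.2) hθ.1.le (by ring)
      have h := isMinOn_iff.mp hmin _ hmem
      have hpr : proj ((1 - θ) • y + θ • z) - proj a =
          (proj y - proj a) + θ • (proj z - proj y) := by
        have : proj ((1 - θ) • y + θ • z) = (1 - θ) • proj y + θ • proj z := by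
          change projLin _ = (1 - θ) • projLin _ + θ • projLin _
          rw [map_add, map_smul, map_smul]
        rw [this]
        module
      rw [hpr, norm_add_sq_real, inner_smul_right, norm_smul, Real.norm_of_nonneg hθ.1.le] at h
      simp only [PiLp.add_apply, PiLp.smul_apply, smul_eq_mul] at h
      refine nonneg_of_mul_nonneg_right (a := θ) ?_ hθ.1
      linarith
    have hlim : 0 ≤ 2 * inner ℝ (proj y - proj a) (proj z - proj y) - δ * (z 2 - y 2) := by
      have hcont : Tendsto (fun θ : ℝ => 2 * inner ℝ (proj y - proj a) (proj z - proj y)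
          - δ * (z 2 - y 2) + θ * ‖proj z - proj y‖ ^ 2) (𝓝[>] 0)
          (𝓝 (2 * inner ℝ (proj y - proj a) (proj z - proj y) - δ * (z 2 - y 2)
            + 0 * ‖proj z - proj y‖ ^ 2)) :=
        ((by fun_prop : Continuous fun θ : ℝ =>
          2 * inner ℝ (proj y - proj a) (proj z - proj y)
          - δ * (z 2 - y 2) + θ * ‖proj z - proj y‖ ^ 2).tendsto 0).mono_left nhdsWithin_le_nhds
      rw [zero_mul, add_zero] at hcont
      exact ge_of_tendsto hcont (Filter.mem_of_superset (Ioc_mem_nhdsGT one_pos) hfirst)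
    have hw : ∀ x : Plane, δ * inner ℝ x w = 2 * inner ℝ (proj y - proj a) x := fun x => by
      rw [real_inner_comm, inner_smul_left]
      simp only [map_div₀, RCLike.conj_to_real]
      field_simp
    refine le_of_mul_le_mul_left ?_ hδ
    rw [tilt_eq, tilt_eq, mul_sub, mul_sub, hw, hw]
    rw [inner_sub_right] at hlim
    linarith
  · have h := isMinOn_iff.mp hmin a ha
    simp only [sub_self, norm_zero] at h
    have h1 := (abs_le.mp (hH2 y hy)).2
    have h2 := (abs_le.mp (hH2 a ha)).1
    have h3 : δ * (y 2 - a 2) ≤ δ * (2 * H) := mul_le_mul_of_nonneg_left (by linarith) hδ.le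
    have h4 : δ * (2 * H + 1) = ε ^ 2 := div_mul_cancel₀ _ (by positivity)
    rw [dist_comm, dist_eq_norm]
    exact lt_of_pow_lt_pow_left₀ 2 hε.le (by linarith)

theorem isSubdivision_newtonSubdivision (hP : P ≠ 0) :
    IsSubdivision (newtonSubdivision P) (newtonPolygonZero P) where
  complex :=
    { finite := newtonSubdivision_finite P
      nonempty := by
        rintro _ ⟨w, rfl⟩
        exact subCell_nonempty hP w
      face := by
        rintro _ ⟨w, rfl⟩ F hne hF
        exact newtonSubdivision_face hP w hne hF
      inter := by
        rintro _ ⟨w, rfl⟩ _ ⟨w', rfl⟩ -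
        exact ⟨isExposed_subCell_inter, Set.inter_comm (subCell P w') (subCell P w) ▸
          isExposed_subCell_inter⟩ }
  polytope := by
    rintro _ ⟨w, rfl⟩
    refine ⟨((minSet_finite P w).image planePoint).toFinset, ?_⟩
    rw [Set.Finite.coe_toFinset]
    exact subCell_eq P w
  cover := newtonSubdivision_cover P

/-! ### The decomposition of the plane by the tropical curve -/

variable (P) in
/-- The closed cell of the plane in which all the terms that are minimal at `w` are minimal. -/
def dualCell (w : Plane) : Set Plane := {u | minSet P w ⊆ minSet P u}

theorem self_mem_dualCell (w : Plane) : w ∈ dualCell P w := Set.Subset.rfl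

theorem dualCell_subset_iff {w w' : Plane} :
    dualCell P w ⊆ dualCell P w' ↔ minSet P w' ⊆ minSet P w :=
  ⟨fun h => h (self_mem_dualCell w), fun h _ hu => h.trans hu⟩

theorem inner_sub_sub_eq_zero {w u v p p' : Plane} (hu : u ∈ dualCell P w) (hv : v ∈ dualCell P w)
    (hp : p ∈ subCell P w) (hp' : p' ∈ subCell P w) : inner ℝ (u - v) (p - p') = 0 := by
  have hsu := subCell_subset_iff.mpr hu
  have hsv := subCell_subset_iff.mpr hv
  refine le_antisymm (inner_sub_sub_nonpos (hsu hp) (hsv hp')) ?_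
  have h := inner_sub_sub_nonpos (hsu hp') (hsv hp)
  rw [← neg_sub p p', inner_neg_right] at h
  linarith

theorem dualCell_polyhedron (P : SortedOperator) (w : Plane) :
    ∃ H : Finset (Plane × ℝ), dualCell P w = {u | ∀ h ∈ H, inner ℝ h.1 u ≤ h.2} := by
  have hfin : ((fun x : (ℕ × ℕ × ℕ) × (ℕ × ℕ × ℕ) => (planePoint x.1 - planePoint x.2,
      (x.1.2.2 : ℝ) - x.2.2.2)) '' (minSet P w ×ˢ exponents P)).Finite :=
    ((minSet_finite P w).prod (exponents_finite P)).image _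
  refine ⟨hfin.toFinset, Set.ext fun u => ?_⟩
  simp only [Set.Finite.mem_toFinset, Set.mem_ofPred_eq, Set.forall_mem_image]
  have key : ∀ e e' : ℕ × ℕ × ℕ, inner ℝ (planePoint e - planePoint e') u ≤
      (e.2.2 : ℝ) - e'.2.2 ↔ tropTerm e u ≤ tropTerm e' u := fun e e' => by
    rw [tropTerm_eq, tropTerm_eq, inner_sub_left]
    constructor <;> intro h <;> linarith
  constructor
  · rintro hu ⟨e, e'⟩ ⟨he, he'⟩
    exact (key e e').mpr ((hu he).2 e' he')
  · exact fun h e he => ⟨he.1, fun e' he' => (key e e').mp (h (x := (e, e')) ⟨he, he'⟩)⟩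

theorem dualCell_convex (P : SortedOperator) (w : Plane) : Convex ℝ (dualCell P w) := by
  obtain ⟨H, hH⟩ := dualCell_polyhedron P w
  rw [hH]
  have : {u : Plane | ∀ h ∈ H, inner ℝ h.1 u ≤ h.2} = ⋂ h ∈ H, {u | innerSL ℝ h.1 u ≤ h.2} := by
    ext u
    simp
  rw [this]
  exact convex_iInter₂ fun h _ => convex_halfSpace_le (innerSL ℝ h.1).isLinear _

/-- Terms that are minimal at the midpoint of two points of a cell are minimal at both. -/
theorem minSet_midpoint_subset (hP : P ≠ 0) {w u v : Plane} (hu : u ∈ dualCell P w)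
    (hv : v ∈ dualCell P w) : minSet P (midpoint ℝ u v) ⊆ minSet P u ∩ minSet P v := by
  obtain ⟨e₀, he₀⟩ := minSet_nonempty hP w
  have hmid : ∀ e, 2 * tropTerm e (midpoint ℝ u v) = tropTerm e u + tropTerm e v := fun e => by
    simp only [tropTerm_eq, midpoint_eq_smul_add, inner_smul_right, inner_add_right, invOf_eq_inv]
    ring
  intro e he
  have h := he.2 e₀ he₀.1
  have h1 := (hu he₀).2 e he.1
  have h2 := (hv he₀).2 e he.1
  have h3 := hmid e
  have h4 := hmid e₀
  exact ⟨⟨he.1, fun e' he' => by linarith [(hu he₀).2 e' he']⟩,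
    ⟨he.1, fun e' he' => by linarith [(hv he₀).2 e' he']⟩⟩

/-- Cells of the decomposition of the plane that meet, meet in a face. -/
theorem isExposed_dualCell_inter (hP : P ≠ 0) {w w' : Plane} :
    IsExposed ℝ (dualCell P w) (dualCell P w ∩ dualCell P w') := by
  rintro ⟨u₀, hu₀, hu₀'⟩
  obtain ⟨e₀, he₀⟩ := minSet_nonempty hP w
  set T := (minSet_finite P w').toFinset
  have hT : ∀ e, e ∈ T ↔ e ∈ minSet P w' := fun e => Set.Finite.mem_toFinset _
  -- on the first cell `e₀` is minimal, and the points of the second cell are those at which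
  -- the sum of the differences to the terms in `T` vanishes
  set g : Plane → ℝ := fun u => ∑ e ∈ T, (tropTerm e₀ u - tropTerm e u)
  have hg : ∀ u ∈ dualCell P w, ∀ e ∈ T, tropTerm e₀ u - tropTerm e u ≤ 0 := fun u hu e he =>
    sub_nonpos.mpr ((hu he₀).2 e ((hT e).mp he).1)
  have hg0 : ∀ u ∈ dualCell P w, u ∈ dualCell P w' → g u = 0 := fun u hu hu' =>
    Finset.sum_eq_zero fun e he =>
      sub_eq_zero.mpr (tropTerm_eq_of_mem (hu he₀) (hu' ((hT e).mp he)))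
  set l : StrongDual ℝ Plane := innerSL ℝ (∑ e ∈ T, (planePoint e₀ - planePoint e))
  have hl : ∀ u v, g u - g v = l u - l v := fun u v => by
    simp only [g, l, innerSL_apply_apply, sum_inner, ← Finset.sum_sub_distrib]
    refine Finset.sum_congr rfl fun e _ => ?_
    simp only [tropTerm_eq, inner_sub_left]
    ring
  refine ⟨l, Set.ext fun u => ⟨fun ⟨hu, hu'⟩ => ⟨hu, fun v hv => ?_⟩, fun ⟨hu, hm⟩ => ⟨hu, ?_⟩⟩⟩
  · have h1 : g v ≤ 0 := Finset.sum_nonpos (hg v hv)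
    have h2 := hl u v
    have h3 := hg0 u hu hu'
    linarith
  · have h1 := hm u₀ hu₀
    have h2 := hl u u₀
    have h3 := hg0 u₀ hu₀ hu₀'
    have h4 : g u ≤ 0 := Finset.sum_nonpos (hg u hu)
    have h5 : g u = 0 := by linarith
    intro e he
    have h6 := (Finset.sum_eq_zero_iff_of_nonpos (hg u hu)).mp h5 e ((hT e).mpr he)
    refine ⟨he.1, fun e' he' => ?_⟩
    rw [← sub_eq_zero.mp h6]
    exact (hu he₀).2 e' he'

/-- The faces of a cell of the decomposition of the plane are cells. -/
theorem dualCell_face (hP : P ≠ 0) (w₀ : Plane) {F : Set Plane} (hne : F.Nonempty)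
    (hF : IsExposed ℝ (dualCell P w₀) F) : F ∈ Set.range (dualCell P) := by
  -- a point with the fewest minimal terms lies in the relative interior of the face
  obtain ⟨w, hw, hmin⟩ := exists_minimalFor_of_wellFoundedLT (· ∈ F)
    (fun w => (minSet P w).ncard) hne
  refine ⟨w, Set.Subset.antisymm (fun u hu => ?_) fun u hu => ?_⟩
  · obtain ⟨l, rfl⟩ := hF hne
    have hw₀u : u ∈ dualCell P w₀ := Set.Subset.trans hw.1 hu
    have horth : ∀ e ∈ minSet P w, ∀ e' ∈ minSet P w,
        inner ℝ (planePoint e) (w - u) = inner ℝ (planePoint e') (w - u) := by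
      intro e he e' he'
      have h := inner_sub_sub_eq_zero (self_mem_dualCell w) hu (planePoint_mem_subCell he)
        (planePoint_mem_subCell he')
      rw [real_inner_comm, inner_sub_left] at h
      linarith
    -- the segment from `u` to `w` can be prolonged beyond `w` inside the cell
    obtain ⟨t, ht, ht0⟩ := ((eventually_minSet_line_eq hP horth).and self_mem_nhdsWithin).exists
    have ht0 : 0 < t := ht0
    have hmem : w + t • (w - u) ∈ dualCell P w₀ := by
      change minSet P w₀ ⊆ _
      rw [ht]
      exact hw.1
    have h1 := hw.2 _ hmem
    rw [map_add, map_smul, map_sub, smul_eq_mul] at h1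
    have h2 : l w ≤ l u := by
      by_contra! h
      have := mul_pos ht0 (sub_pos.mpr h)
      linarith
    exact ⟨hw₀u, fun v hv => (hw.2 v hv).trans h2⟩
  · have hsub := hF.subset
    have hm := minSet_midpoint_subset hP (hsub hw) (hsub hu)
    have hmF : midpoint ℝ w u ∈ F := (hF.convex (dualCell_convex P w₀)).midpoint_mem hw hu
    have hle : (minSet P (midpoint ℝ w u)).ncard ≤ (minSet P w).ncard :=
      Set.ncard_le_ncard (fun e he => (hm he).1) (minSet_finite P w)
    have heq := Set.eq_of_subset_of_ncard_le (fun e he => (hm he).1 :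
      minSet P (midpoint ℝ w u) ⊆ minSet P w) (hmin hmF hle) (minSet_finite P w)
    exact fun e he => (hm (heq ▸ he)).2

theorem isPlaneDecomposition_range_dualCell (hP : P ≠ 0) :
    IsPlaneDecomposition (Set.range (dualCell P)) where
  complex :=
    { finite := by
        refine ((exponents_finite P).finite_subsets.image fun F => {u | F ⊆ minSet P u}).subset ?_
        rintro _ ⟨w, rfl⟩
        exact ⟨minSet P w, fun e he => he.1, rfl⟩
      nonempty := by
        rintro _ ⟨w, rfl⟩
        exact ⟨w, self_mem_dualCell w⟩
      face := by
        rintro _ ⟨w, rfl⟩ F hne hF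
        exact dualCell_face hP w hne hF
      inter := by
        rintro _ ⟨w, rfl⟩ _ ⟨w', rfl⟩ -
        exact ⟨isExposed_dualCell_inter hP, Set.inter_comm (dualCell P w') (dualCell P w) ▸
          isExposed_dualCell_inter hP⟩ }
  polyhedron := by
    rintro _ ⟨w, rfl⟩
    exact dualCell_polyhedron P w
  cover := Set.eq_univ_of_forall fun w => ⟨_, ⟨w, rfl⟩, self_mem_dualCell w⟩

/-! ### Duality -/

/-- The inclusion `≤` holds because corresponding cells are perpendicular; conversely, moving `w`
slightly in a direction orthogonal to the cell of the subdivision keeps the same terms minimal. -/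
theorem vectorSpan_dualCell (hP : P ≠ 0) (w : Plane) :
    vectorSpan ℝ (dualCell P w) = (vectorSpan ℝ (subCell P w))ᗮ := by
  apply le_antisymm
  · rw [vectorSpan_def, vectorSpan_def, ← Submodule.isOrtho_iff_le, Submodule.isOrtho_span]
    rintro _ ⟨u, hu, v, hv, rfl⟩ _ ⟨p, hp, p', hp', rfl⟩
    exact inner_sub_sub_eq_zero hu hv hp hp'
  · intro d hd
    have horth : ∀ e ∈ minSet P w, ∀ e' ∈ minSet P w,
        inner ℝ (planePoint e) d = inner ℝ (planePoint e') d := fun e he e' he' => by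
      have h := Submodule.inner_right_of_mem_orthogonal (vsub_mem_vectorSpan ℝ
        (planePoint_mem_subCell he) (planePoint_mem_subCell he')) hd
      rw [vsub_eq_sub, inner_sub_left] at h
      linarith
    obtain ⟨t, ht, ht0⟩ := ((eventually_minSet_line_eq hP horth).and self_mem_nhdsWithin).exists
    have ht0 : 0 < t := ht0
    have hmem : w + t • d ∈ dualCell P w := ht.ge
    have h := vsub_mem_vectorSpan ℝ hmem (self_mem_dualCell w)
    rw [vsub_eq_sub, add_sub_cancel_left] at h
    exact (Submodule.smul_mem_iff _ ht0.ne').mp h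

theorem cellDim_add_cellDim (hP : P ≠ 0) (w : Plane) :
    cellDim (dualCell P w) + cellDim (subCell P w) = 2 := by
  rw [cellDim, cellDim, vectorSpan_dualCell hP, add_comm, Submodule.finrank_add_finrank_orthogonal,
    finrank_euclideanSpace_fin]

theorem one_le_cellDim_subCell_iff {w : Plane} :
    1 ≤ cellDim (subCell P w) ↔ (minSet P w).Nontrivial := by
  rw [cellDim, Submodule.one_le_finrank_iff]
  constructor
  · contrapose!
    intro h
    rw [subCell_eq, ← direction_affineSpan, affineSpan_convexHull, direction_affineSpan]
    exact vectorSpan_of_subsingleton ℝ (h.image _)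
  · rintro ⟨e, he, e', he', hne⟩ h0
    have h := vsub_mem_vectorSpan ℝ (planePoint_mem_subCell he) (planePoint_mem_subCell he')
    rw [h0, Submodule.mem_bot, vsub_eq_zero_iff_eq] at h
    exact hne (eq_of_planePoint_eq h (tropTerm_eq_of_mem he he'))

theorem mem_tropicalCurve_iff {u : Plane} : u ∈ tropicalCurve P ↔ (minSet P u).Nontrivial := by
  constructor
  · rintro ⟨e, he, e', he', hne, heq, hm⟩
    exact ⟨e, ⟨he, hm⟩, e', ⟨he', fun e'' he'' => heq ▸ hm e'' he''⟩, hne⟩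
  · rintro ⟨e, he, e', he', hne⟩
    exact ⟨e, he.1, e', he'.1, hne, tropTerm_eq_of_mem he he', he.2⟩

theorem tropicalCurve_eq (hP : P ≠ 0) :
    tropicalCurve P = ⋃₀ {C ∈ Set.range (dualCell P) | cellDim C ≤ 1} := by
  have hdim : ∀ w, cellDim (dualCell P w) ≤ 1 ↔ (minSet P w).Nontrivial := fun w => by
    rw [← one_le_cellDim_subCell_iff]
    have := cellDim_add_cellDim hP w
    omega
  ext u
  rw [mem_tropicalCurve_iff]
  constructor
  · exact fun h => ⟨_, ⟨⟨u, rfl⟩, (hdim u).mpr h⟩, self_mem_dualCell u⟩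
  · rintro ⟨_, ⟨⟨w, rfl⟩, hw⟩, hu⟩
    exact ((hdim w).mp hw).mono hu

theorem newtonPolygonZero_convex (P : SortedOperator) : Convex ℝ (newtonPolygonZero P) := by
  rw [newtonPolygonZero_eq]
  exact convex_convexHull ℝ _

theorem newtonPolygonZero_isClosed (P : SortedOperator) : IsClosed (newtonPolygonZero P) := by
  rw [newtonPolygonZero_eq]
  exact (((exponents_finite P).image _).isCompact_convexHull ℝ).isClosed

/-- If a cell of the subdivision contains an interior point `p` of the polygon, its dual cell is
bounded: for `u` in the dual cell the linear function `u` differs on the polygon from its value at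
`p` by no more than the variation of the last coordinate. -/
theorem isBounded_dualCell {w p : Plane} (hp : p ∈ subCell P w)
    (hpi : p ∈ interior (newtonPolygonZero P)) : Bornology.IsBounded (dualCell P w) := by
  obtain ⟨H, hH⟩ := (newtonPolytope_isCompact P).isBounded.exists_norm_le
  have hH2 : ∀ y ∈ newtonPolytope P, |y 2| ≤ H := fun y hy =>
    (PiLp.norm_apply_le y 2).trans (hH y hy)
  obtain ⟨ε, hε, hball⟩ := Metric.nhds_basis_closedBall.mem_iff.mp (mem_interior_iff_mem_nhds.mp hpi)
  refine isBounded_iff_forall_norm_le.mpr ⟨2 * H / ε, fun u hu => ?_⟩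
  rw [le_div_iff₀ hε]
  obtain ⟨y, hy, rfl⟩ := subCell_subset_iff.mpr hu hp
  rcases eq_or_ne u 0 with rfl | hu0
  · have := (abs_nonneg _).trans (hH2 y hy.1)
    simpa using this
  have hn : ‖u‖ ≠ 0 := norm_ne_zero_iff.mpr hu0
  have hmem : proj y - (ε / ‖u‖) • u ∈ newtonPolygonZero P := hball (by
    rw [Metric.mem_closedBall, dist_eq_norm, sub_sub_cancel_left, norm_neg, norm_smul, norm_div,
      norm_norm, div_mul_cancel₀ _ hn, Real.norm_of_nonneg hε.le])
  obtain ⟨z, hz, hzy⟩ := hmem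
  have h := (mem_lowerFace_iff.mp hy).2 z hz
  rw [tilt_eq, tilt_eq, hzy, inner_sub_left, inner_smul_left, real_inner_self_eq_norm_sq] at h
  have h1 := (abs_le.mp (hH2 y hy.1)).2
  have h2 := (abs_le.mp (hH2 z hz)).1
  have h3 : (starRingEnd ℝ) (ε / ‖u‖) * ‖u‖ ^ 2 = ‖u‖ * ε := by
    simp only [RCLike.conj_to_real]
    field_simp
  rw [h3] at h
  linarith

/-- If a cell of the subdivision lies on the boundary of the polygon, a functional that supports the
polygon at the centroid of the cell is minimal on all of the cell, and the dual cell contains a ray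
in its direction. -/
theorem not_isBounded_dualCell (hP : P ≠ 0) {w : Plane}
    (hw : subCell P w ⊆ frontier (newtonPolygonZero P)) :
    ¬ Bornology.IsBounded (dualCell P w) := by
  set T := (minSet_finite P w).toFinset
  have hT : ∀ e, e ∈ T ↔ e ∈ minSet P w := fun e => Set.Finite.mem_toFinset _
  have hTne : T.Nonempty := let ⟨e, he⟩ := minSet_nonempty hP w; ⟨e, (hT e).mpr he⟩
  have hcard : (T.card : ℝ) ≠ 0 := by exact_mod_cast hTne.card_pos.ne'
  set c : Plane := ∑ e ∈ T, (T.card : ℝ)⁻¹ • planePoint e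
  have hc : c ∈ subCell P w := by
    have hconv : Convex ℝ (subCell P w) := subCell_eq P w ▸ convex_convexHull ℝ _
    refine hconv.sum_mem (fun _ _ => by positivity) ?_ fun e he =>
      planePoint_mem_subCell ((hT e).mp he)
    rw [Finset.sum_const, nsmul_eq_mul, mul_inv_cancel₀ hcard]
  obtain ⟨d, hd0, hd⟩ := exists_supporting (newtonPolygonZero_convex P) (subCell_subset w hc)
    (hw hc).2
  have hpt : ∀ e ∈ exponents P, planePoint e ∈ newtonPolygonZero P := fun e he => by
    rw [newtonPolygonZero_eq]
    exact subset_convexHull ℝ _ ⟨e, he, rfl⟩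
  have hsum : ∑ e ∈ T, (inner ℝ d (planePoint e) - inner ℝ d c) = 0 := by
    rw [Finset.sum_sub_distrib, Finset.sum_const, nsmul_eq_mul]
    simp only [c, ← Finset.smul_sum, inner_smul_right, inner_sum]
    rw [mul_inv_cancel_left₀ hcard, sub_self]
  have hTeq : ∀ e ∈ minSet P w, inner ℝ d (planePoint e) = inner ℝ d c := fun e he =>
    sub_eq_zero.mp ((Finset.sum_eq_zero_iff_of_nonneg fun e' he' =>
      sub_nonneg.mpr (hd _ (hpt e' ((hT e').mp he').1))).mp hsum e ((hT e).mpr he))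
  have hray : ∀ t : ℝ, 0 ≤ t → w + t • d ∈ dualCell P w := fun t ht e he =>
    ⟨he.1, fun e' he' => by
      rw [tropTerm_add_smul, tropTerm_add_smul, real_inner_comm d, hTeq e he, real_inner_comm d]
      exact add_le_add (he.2 e' he') (mul_le_mul_of_nonneg_left (hd _ (hpt e' he')) ht)⟩
  intro hb
  obtain ⟨R, hR⟩ := isBounded_iff_forall_norm_le.mp hb
  have hR0 : 0 ≤ R := (norm_nonneg w).trans (hR w (self_mem_dualCell w))
  have hdn : ‖d‖ ≠ 0 := norm_ne_zero_iff.mpr hd0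
  have h := hR _ (hray ((R + ‖w‖ + 1) / ‖d‖) (by positivity))
  have h2 : ‖((R + ‖w‖ + 1) / ‖d‖) • d‖ = R + ‖w‖ + 1 := by
    rw [norm_smul, Real.norm_of_nonneg (by positivity), div_mul_cancel₀ _ hdn]
  have h3 := norm_sub_le (w + ((R + ‖w‖ + 1) / ‖d‖) • d) w
  rw [add_sub_cancel_left, h2] at h3
  linarith

theorem not_isBounded_dualCell_iff (hP : P ≠ 0) {w : Plane} :
    ¬ Bornology.IsBounded (dualCell P w) ↔ subCell P w ⊆ frontier (newtonPolygonZero P) := by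
  refine ⟨fun h p hp => ?_, not_isBounded_dualCell hP⟩
  rw [(newtonPolygonZero_isClosed P).frontier_eq]
  exact ⟨subCell_subset w hp, fun hpi => h (isBounded_dualCell hp hpi)⟩

/-- Two families indexed by the same set that identify the same indices have ranges in bijection. -/
theorem exists_range_equiv {α β γ : Type*} {f : α → β} {g : α → γ}
    (h : ∀ a b, f a = f b ↔ g a = g b) :
    ∃ φ : Set.range f ≃ Set.range g, ∀ x : Set.range f, ∃ a, (x : β) = f a ∧ (φ x : γ) = g a := by
  refine ⟨(Setoid.quotientKerEquivRange f).symm.trans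
    ((Quotient.congrRight fun a b => h a b).trans (Setoid.quotientKerEquivRange g)), fun x => ?_⟩
  obtain ⟨q, rfl⟩ := (Setoid.quotientKerEquivRange f).surjective x
  induction q using Quotient.inductionOn with
  | h a =>
    refine ⟨a, rfl, ?_⟩
    rw [Equiv.trans_apply, Equiv.symm_apply_apply]
    rfl

theorem isDual_newtonSubdivision (hP : P ≠ 0) :
    IsDual (tropicalCurve P) (newtonSubdivision P) (newtonPolygonZero P) := by
  have heq : ∀ w w', dualCell P w = dualCell P w' ↔ subCell P w = subCell P w' := fun w w' => by
    rw [Set.Subset.antisymm_iff, Set.Subset.antisymm_iff, dualCell_subset_iff, dualCell_subset_iff,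
      subCell_subset_iff, subCell_subset_iff, and_comm]
  obtain ⟨φ, hφ⟩ := exists_range_equiv heq
  rw [show newtonSubdivision P = Set.range (subCell P) from rfl]
  refine ⟨Set.range (dualCell P), isPlaneDecomposition_range_dualCell hP, tropicalCurve_eq hP, φ,
    fun C D => ?_, fun C => ?_, fun C => ?_, fun C => ?_, fun C D => ?_⟩ <;>
    obtain ⟨w, hC, hφC⟩ := hφ C
  · obtain ⟨w', hD, hφD⟩ := hφ D
    rw [hC, hφC, hD, hφD]
    exact dualCell_subset_iff.trans subCell_subset_iff.symm
  · rw [hC, hφC]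
    exact cellDim_add_cellDim hP w
  · rw [hC, hφC]
    exact fun u hu v hv p hp p' hp' => inner_sub_sub_eq_zero hu hv hp hp'
  · rw [hC, hφC]
    exact not_isBounded_dualCell_iff hP
  · obtain ⟨w', hD, hφD⟩ := hφ D
    rw [hC, hφC, hD, hφD]
    exact fun u hu v hv p hp p' hp' =>
      inner_sub_sub_nonpos (subCell_subset_iff.mpr hu hp) (subCell_subset_iff.mpr hv hp')

/-- The element `0` divides all coefficients of the zero operator and is not a unit. -/
theorem IsReduced.ne_zero (h : IsReduced P) : P ≠ 0 := by
  rintro rfl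
  exact not_isUnit_zero (h 0 fun i => by simp)

end TropicalKnot
end

open TropicalKnot
theorem proposition3p1 (K : KnotDiagram)
    (P : SortedOperator) (hP : IsNoncommutativeAPolynomial K P)
    (A : MvPolynomial (Fin 2) ℤ) (hA : IsAPolynomial K A)
    (hgood : IsGood P)
    (B : Polynomial ℤ) (hAJ : AJRelation P A B) :
    newtonPolygonZero P = newtonPolygon (halfPower A * inM B) ∧
    newtonPolygon (inM B) =
      segment ℝ (!₂[0, (B.natTrailingDegree : ℝ)] : Plane) !₂[0, (B.natDegree : ℝ)] ∧
    newtonPolygon (halfPower A * inM B) =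
      newtonPolygon (halfPower A) +
        segment ℝ (!₂[0, (B.natTrailingDegree : ℝ)] : Plane) !₂[0, (B.natDegree : ℝ)] ∧
    IsSubdivision (newtonSubdivision P) (newtonPolygon (halfPower A * inM B)) ∧
    IsDual (tropicalCurve P) (newtonSubdivision P) (newtonPolygon (halfPower A * inM B)) := by
  have hP0 : P ≠ 0 := hP.1.ne_zero
  have hN : newtonPolygonZero P = newtonPolygon (halfPower A * inM B) := by
    rw [← hgood, newtonPolygonOne, hAJ, mul_comm]
  have hB : B ≠ 0 := by
    rintro rfl
    have hne : (newtonPolygonZero P).Nonempty := (subCell_nonempty hP0 0).mono (subCell_subset 0)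
    rw [hN, newtonPolygon_nonempty] at hne
    simp [inM] at hne
  have hM := newtonPolygon_inM hB
  refine ⟨hN, hM, by rw [newtonPolygon_mul, hM], ?_⟩
  rw [← hN]
  exact ⟨isSubdivision_newtonSubdivision hP0, isDual_newtonSubdivision hP0⟩
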